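/- Let $L>0$. Let $a\in L^\infty(0,L)$ satisfy $\alpha\le a(x)\le\beta$ for a.e. $x\in(0,L)$, for some constants $0<\alpha<\beta$. Let $\phi:\mathbb{R}\to\mathbb{R}\cup\{+\infty\}$ be continuous with values in $\mathbb{R}\cup\{+\infty\}$, with $\phi(0)=+\infty$ and $\phi(s)<+\infty$ for all $s\neq 0$. Assume that $\phi$ is integrable at $0$, i.e. $\int_0^{\delta}\phi(t)\,dt<+\infty$ and $\int_{-\delta}^0\phi(t)\,dt<+\infty$ for every $0<\delta<1$, and that $\phi$ is bounded on $\mathbb{R}\setminus(-\delta,\delta)$ for every $\delta>0$. For $g\in L^2(0,L)$, a weak solution of $$-\frac{d}{dx}\Big(a(x)\frac{du}{dx}\Big)=-\frac{d\phi(u)}{dx}-\frac{dg}{dx}\ \text{ in }(0,L),\qquad u(0)=u(L)=0,\tag{S}$$ is a function $u\in H^1_0(0,L)$ such that $\phi(u)\in L^2(0,L)$ (in particular $\phi(u)$ is finite a.e.) and the equation holds in $\mathcal{D}'(0,L)$, i.e. $$\int_0^L a\,\frac{du}{dx}\,\frac{d\eta}{dx}\,dx=\int_0^L\phi(u)\,\frac{d\eta}{dx}\,dx+\int_0^L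 g\,\frac{d\eta}{dx}\,dx\qquad\text{for all }\eta\in C_c^\infty(0,L).$$ Then for every $g\in L^2(0,L)$ and every $\delta$ with $0<\delta<L$ there exists $\hat g\in L^2(0,L)$ with $\hat g=g$ on $[0,L-\delta]$ such that (S), with $g$ replaced by $\hat g$, has at least one weak solution. -/

import Mathlib

open MeasureTheory Set
open scoped ContDiff

/-- Lebesgue measure on the open interval `(0, L)`. -/
noncomputable def intervalMeasure (L : ℝ) : Measure ℝ :=
  volume.restrict (Ioo 0 L)

/-- Test functions in `C_c^∞(0, L)`. -/
structure IsTestFunction (L : ℝ) (η : ℝ → ℝ) : Prop where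
  smooth : ContDiff ℝ ∞ η
  compact : HasCompactSupport η
  support : tsupport η ⊆ Ioo 0 L

/-- `w` is the distributional derivative of `z` on `(0, L)`
(used below for `z` and `w` in `L²(0, L)`). -/
def IsWeakDeriv (L : ℝ) (z w : ℝ → ℝ) : Prop :=
  ∀ η : ℝ → ℝ, IsTestFunction L η →
    ∫ x, z x * deriv η x ∂(intervalMeasure L) = -∫ x, w x * η x ∂(intervalMeasure L)

/-- `u` (the representative that is continuous on `[0, L]`) belongs to `H¹₀(0, L)`,
and `u'` is its distributional derivative. -/
structure IsH10 (L : ℝ) (u u' : ℝ → ℝ) : Prop where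
  continuousOn : ContinuousOn u (Icc 0 L)
  memLp : MemLp u 2 (intervalMeasure L)
  memLp_deriv : MemLp u' 2 (intervalMeasure L)
  weakDeriv : IsWeakDeriv L u u'
  left : u 0 = 0
  right : u L = 0

/-- An extended-real-valued function belongs to `L²(0, L)`: it is finite almost everywhere and
the real function it then defines is in `L²`. -/
def EMemL2 (L : ℝ) (f : ℝ → EReal) : Prop :=
  (∀ᵐ x ∂(intervalMeasure L), f x ≠ ⊤ ∧ f x ≠ ⊥) ∧
    MemLp (fun x => (f x).toReal) 2 (intervalMeasure L)

/-- `a ∈ L^∞(0, L)` lies between two positive constants almost everywhere. -/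
def IsCoefficient (L : ℝ) (a : ℝ → ℝ) : Prop :=
  MemLp a ⊤ (intervalMeasure L) ∧
    ∃ α β : ℝ, 0 < α ∧ α < β ∧ ∀ᵐ x ∂(intervalMeasure L), α ≤ a x ∧ a x ≤ β

/-- `φ : ℝ → ℝ ∪ {+∞}` is continuous with values in `ℝ ∪ {+∞}` (a subspace of `EReal`)
and finite outside `0`. -/
structure IsNonlinearity (φ : ℝ → EReal) : Prop where
  continuous : Continuous φ
  ne_bot : ∀ s, φ s ≠ ⊥
  ne_top : ∀ s, s ≠ 0 → φ s ≠ ⊤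

/-- `φ` is integrable at `0` from the right and from the left. On these open intervals `φ` is
finite, and it is bounded below there, so that integrability is finiteness of the integral. -/
def IsIntegrableNearZero (φ : ℝ → EReal) : Prop :=
  ∀ δ : ℝ, 0 < δ → δ < 1 →
    IntegrableOn (fun t => (φ t).toReal) (Ioo 0 δ) ∧
      IntegrableOn (fun t => (φ t).toReal) (Ioo (-δ) 0)

/-- `φ` is bounded on `ℝ \ (-δ, δ)` for every `δ > 0`. -/
def IsBoundedAwayFromZero (φ : ℝ → EReal) : Prop :=
  ∀ δ : ℝ, 0 < δ → ∃ C : ℝ, ∀ s : ℝ, δ ≤ |s| → |(φ s).toReal| ≤ C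

/-- `u` is a weak solution of `-(a u')' = -(φ(u))' - g'` in `(0, L)`, `u(0) = u(L) = 0`:
`u ∈ H¹₀(0, L)`, `φ(u) ∈ L²(0, L)`, and the equation holds in the sense of distributions. -/
def IsWeakSolution (L : ℝ) (a g : ℝ → ℝ) (φ : ℝ → EReal) (u : ℝ → ℝ) : Prop :=
  ∃ u' : ℝ → ℝ, IsH10 L u u' ∧ EMemL2 L (fun x => φ (u x)) ∧
    ∀ η : ℝ → ℝ, IsTestFunction L η →
      ∫ x, a x * u' x * deriv η x ∂(intervalMeasure L) =
        ∫ x, (φ (u x)).toReal * deriv η x ∂(intervalMeasure L) +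
          ∫ x, g x * deriv η x ∂(intervalMeasure L)

/-- The data `g ∈ L²(0, L)` for which at least one weak solution exists. -/
def goodData (L : ℝ) (a : ℝ → ℝ) (φ : ℝ → EReal) : Set (ℝ → ℝ) :=
  {g | MemLp g 2 (intervalMeasure L) ∧ ∃ u : ℝ → ℝ, IsWeakSolution L a g φ u}

open Filter Topology NNReal ENNReal

/-! In one dimension the equation follows from its first integral `a u' = φ(u) + g`, a first-order
equation that can be solved forward from `u(0) = 0`. The only remaining constraint is `u(L) = 0`,
and the freedom to change `g` on the last interval of length `δ` is used to meet it.

The forward problem is singular where `φ(u) = ∞`. After adding a constant, `ψ = φ + K ≥ 0` is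
approximated from below by Lipschitz functions `f`. Multiplying `u' = (f(u) + g) m`, with `m = 1/a`,
by `f(u)` turns the left side into the exact integral `∫₀^{u(T)} f`. This grows at most linearly in
`u(T)`, because `φ` is integrable at `0` and bounded elsewhere. The right side controls `∫ f(u)²`,
so the bound is uniform in the approximation (`energy_estimate`). Compactness and Fatou's lemma then
give a solution with `ψ(u) ∈ L²` (`exists_singular_ode_solution`).

On the first half of the free interval, extra forcing makes `u` positive. On the second half, `u` is
continued by a reversed and rescaled solution of another singular problem, which reaches `0` at `L`
and keeps `ψ(u)` in `L²`. Where the datum is free, the equation serves as its definition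
(`exists_goodData_of_profile`). -/

/-! ### Chain rule for absolutely continuous functions and the regular Volterra equation -/

theorem LipschitzWith.comp_absolutelyContinuousOnInterval {X Y : Type*} [PseudoMetricSpace X]
    [PseudoMetricSpace Y] {K : ℝ≥0} {F : X → Y} (hF : LipschitzWith K F) {u : ℝ → X} {a b : ℝ}
    (hu : AbsolutelyContinuousOnInterval u a b) :
    AbsolutelyContinuousOnInterval (fun x => F (u x)) a b := by
  refine squeeze_zero (fun t => ?_) (fun t => ?_) (by simpa using Tendsto.const_mul (K : ℝ) hu)
  · exact Finset.sum_nonneg fun i _ => dist_nonneg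
  · rw [Finset.mul_sum]
    exact Finset.sum_le_sum fun i _ => hF.dist_le_mul _ _

/-- Here `u` is differentiable only almost everywhere. Boundedness of `f` makes its primitive
Lipschitz, so the composition with `u` is still absolutely continuous and the fundamental theorem of
calculus applies. -/
theorem intervalIntegral_comp_mul_eq {f h u : ℝ → ℝ} {T C : ℝ} (hT : 0 ≤ T) (hf : Continuous f)
    (hC : ∀ s, |f s| ≤ C) (hh : IntervalIntegrable h volume 0 T)
    (hu : ∀ x ∈ Icc 0 T, u x = ∫ t in 0..x, h t) :
    ∫ t in 0..T, f (u t) * h t = ∫ s in 0..u T, f s := by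
  set U : ℝ → ℝ := fun x => ∫ t in 0..x, h t with hU
  set Φ : ℝ → ℝ := fun s => ∫ t in 0..s, f t with hΦ
  have hΦd : ∀ s, HasDerivAt Φ (f s) s := fun s =>
    intervalIntegral.integral_hasDerivAt_right (hf.intervalIntegrable _ _)
      hf.aestronglyMeasurable.stronglyMeasurableAtFilter hf.continuousAt
  have hC0 : 0 ≤ C := (abs_nonneg _).trans (hC 0)
  have hΦL : LipschitzWith C.toNNReal Φ := by
    refine lipschitzWith_of_nnnorm_deriv_le (fun s => (hΦd s).differentiableAt) fun s => ?_
    rw [(hΦd s).deriv, ← NNReal.coe_le_coe, coe_nnnorm, Real.coe_toNNReal _ hC0]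
    exact hC s
  have hUac : AbsolutelyContinuousOnInterval U 0 T :=
    hh.absolutelyContinuousOnInterval_intervalIntegral left_mem_uIcc
  have hac := hΦL.comp_absolutelyContinuousOnInterval hUac
  have hftc := hac.integral_deriv_eq_sub
  have h0 : U 0 = 0 := by simp [hU]
  have hΦ0 : Φ 0 = 0 := by simp [hΦ]
  rw [h0, hΦ0, sub_zero] at hftc
  rw [hu T (right_mem_Icc.2 hT)]
  change _ = Φ (U T)
  rw [← hftc]
  refine intervalIntegral.integral_congr_ae ?_
  filter_upwards [hh.ae_hasDerivAt_integral] with x hx hxT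
  have hxI : x ∈ uIcc 0 T := uIoc_subset_uIcc hxT
  have hd := (hΦd (U x)).comp x (hx hxI 0 left_mem_uIcc)
  have : deriv (fun x => Φ (U x)) x = f (U x) * h x := hd.deriv
  rw [this, hu x (by rwa [uIcc_of_le hT] at hxI)]

theorem IntervalIntegrable.mul_of_bounded {p m : ℝ → ℝ} {a b M : ℝ}
    (hp : IntervalIntegrable p volume a b) (hm : Measurable m) (hM : ∀ x, |m x| ≤ M) :
    IntervalIntegrable (fun t => p t * m t) volume a b := by
  rw [intervalIntegrable_iff] at hp ⊢
  exact hp.mul_bdd hm.aestronglyMeasurable (ae_of_all _ hM)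

theorem MeasureTheory.MemLp.intervalIntegrable_real {g : ℝ → ℝ} (hg : MemLp g 2 volume)
    (a b : ℝ) : IntervalIntegrable g volume a b :=
  ((hg.locallyIntegrable one_le_two).integrableOn_isCompact isCompact_uIcc).intervalIntegrable

/-- Picard iteration in the unknown `w(t) = exp(-l t) u(t)`: for large `l` the exponential weight
gives a contraction on all of `[0, T]`, with no smallness of `T`. -/
theorem exists_volterra_solution {f m G : ℝ → ℝ} {K : ℝ≥0} {M T : ℝ} (hT : 0 ≤ T)
    (hf : LipschitzWith K f) (hm : Measurable m) (hM : ∀ x, |m x| ≤ M) (hG : Continuous G) :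
    ∃ u : ℝ → ℝ, Continuous u ∧ ∀ x ∈ Icc 0 T, u x = G x + ∫ t in 0..x, f (u t) * m t := by
  have hM0 : 0 ≤ M := (abs_nonneg _).trans (hM 0)
  have hint : ∀ {w : ℝ → ℝ}, Continuous w → ∀ a b,
      IntervalIntegrable (fun t => w t * m t) volume a b := fun hw a b =>
    (hw.intervalIntegrable a b).mul_of_bounded hm hM
  -- The contraction factor is `K M / l`; this choice makes it at most `1/2`, and the `+ 1` keeps
  -- `l` positive.
  set l : ℝ := 2 * (K * M) + 1 with hl
  have hl0 : 0 < l := by positivity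
  let W : C(Icc 0 T, ℝ) → ℝ → ℝ := fun w t => Real.exp (l * t) * IccExtend hT w t
  have hW : ∀ w, Continuous (W w) := fun w => by
    have : Continuous (IccExtend hT w) := w.continuous.Icc_extend'
    exact (by fun_prop : Continuous fun t : ℝ => Real.exp (l * t)).mul this
  have hfW : ∀ w, Continuous fun t => f (W w t) := fun w => hf.continuous.comp (hW w)
  let F : C(Icc 0 T, ℝ) → ℝ → ℝ := fun w x =>
    Real.exp (-(l * x)) * (G x + ∫ t in 0..x, f (W w t) * m t)
  have hF : ∀ w, Continuous (F w) := fun w =>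
    (by fun_prop : Continuous fun x : ℝ => Real.exp (-(l * x))).mul
      (hG.add (intervalIntegral.continuous_primitive (hint (hfW w)) 0))
  let Fc : C(Icc 0 T, ℝ) → C(Icc 0 T, ℝ) := fun w => ⟨fun x => F w x, (hF w).comp continuous_subtype_val⟩
  have hcontr : ContractingWith (1 / 2) Fc := by
    refine ⟨by rw [← NNReal.coe_lt_coe]; norm_num, LipschitzWith.of_dist_le_mul fun w z => ?_⟩
    rw [ContinuousMap.dist_le (by positivity)]
    rintro ⟨x, hx⟩
    change |F w x - F z x| ≤ _
    have hD : 0 ≤ dist w z := dist_nonneg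
    have hc : IntervalIntegrable (fun t => K * M * dist w z * Real.exp (l * t)) volume 0 x :=
      Continuous.intervalIntegrable (by fun_prop) _ _
    have hbound : |(∫ t in 0..x, f (W w t) * m t) - ∫ t in 0..x, f (W z t) * m t| ≤
        ∫ t in 0..x, K * M * dist w z * Real.exp (l * t) := by
      rw [← intervalIntegral.integral_sub (hint (hfW w) _ _) (hint (hfW z) _ _),
        ← Real.norm_eq_abs]
      refine intervalIntegral.norm_integral_le_of_norm_le hx.1 (ae_of_all _ fun t ht => ?_)
        hc
      rw [← sub_mul, norm_mul]
      have h1 : ‖f (W w t) - f (W z t)‖ ≤ K * (Real.exp (l * t) * dist w z) := by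
        rw [← dist_eq_norm]
        refine (hf.dist_le_mul _ _).trans ?_
        gcongr
        rw [dist_eq_norm, ← mul_sub, norm_mul, Real.norm_eq_abs, abs_of_pos (Real.exp_pos _)]
        gcongr
        rw [← dist_eq_norm]
        exact ContinuousMap.dist_apply_le_dist _
      calc _ ≤ K * (Real.exp (l * t) * dist w z) * M := by
            gcongr
            exact hM t
        _ = _ := by ring
    have hexp : ∫ t in 0..x, K * M * dist w z * Real.exp (l * t) =
        K * M * dist w z * ((Real.exp (l * x) - 1) / l) := by
      rw [intervalIntegral.integral_const_mul, intervalIntegral.integral_comp_mul_left _ hl0.ne',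
        integral_exp]
      simp [div_eq_inv_mul]
    rw [hexp] at hbound
    have hkm : K * M / l ≤ 1 / 2 := by
      rw [div_le_iff₀ hl0]; rw [hl]; linarith
    calc |F w x - F z x| = Real.exp (-(l * x)) *
          |(∫ t in 0..x, f (W w t) * m t) - ∫ t in 0..x, f (W z t) * m t| := by
            simp only [F]
            rw [← mul_sub, abs_mul, abs_of_pos (Real.exp_pos _), add_sub_add_left_eq_sub]
      _ ≤ Real.exp (-(l * x)) * (K * M * dist w z * ((Real.exp (l * x) - 1) / l)) := by gcongr
      _ = K * M / l * dist w z * (Real.exp (-(l * x)) * (Real.exp (l * x) - 1)) := by ring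
      _ ≤ 1 / 2 * dist w z * 1 := by
        have he : Real.exp (-(l * x)) * Real.exp (l * x) = 1 := by
          rw [← Real.exp_add]; simp
        have : Real.exp (-(l * x)) * (Real.exp (l * x) - 1) ≤ 1 := by
          nlinarith [Real.exp_pos (-(l * x))]
        have h2 : 0 ≤ Real.exp (-(l * x)) * (Real.exp (l * x) - 1) := by
          refine mul_nonneg (Real.exp_pos _).le (sub_nonneg.2 (Real.one_le_exp ?_))
          exact mul_nonneg hl0.le hx.1
        gcongr
      _ = _ := by simp
  set w := ContractingWith.fixedPoint Fc hcontr with hw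
  have hfix : Fc w = w := hcontr.fixedPoint_isFixedPt
  refine ⟨W w, hW w, fun x hx => ?_⟩
  have h1 : F w x = w ⟨x, hx⟩ := congrArg (fun z : C(Icc 0 T, ℝ) => z ⟨x, hx⟩) hfix
  have h2 : W w x = Real.exp (l * x) * w ⟨x, hx⟩ := by
    simp only [W, IccExtend_of_mem hT w hx]
  rw [h2, ← h1]
  simp only [F]
  rw [← mul_assoc, ← Real.exp_add]
  simp

/-! ### Lipschitz approximation from below of an extended-valued function -/

/-- The Lipschitz regularisation of `ψ` by inf-convolution, truncated at height `n`. -/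
noncomputable def lipschitzApprox (ψ : ℝ → ℝ≥0∞) (n : ℕ) (s : ℝ) : ℝ :=
  (min (⨅ t, ψ t + n * edist s t) n).toReal

theorem ofReal_lipschitzApprox (ψ : ℝ → ℝ≥0∞) (n : ℕ) (s : ℝ) :
    ENNReal.ofReal (lipschitzApprox ψ n s) = min (⨅ t, ψ t + n * edist s t) n :=
  ENNReal.ofReal_toReal ((min_le_right _ _).trans_lt (ENNReal.natCast_lt_top n)).ne

theorem lipschitzApprox_nonneg (ψ : ℝ → ℝ≥0∞) (n : ℕ) (s : ℝ) : 0 ≤ lipschitzApprox ψ n s :=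
  ENNReal.toReal_nonneg

theorem lipschitzApprox_le (ψ : ℝ → ℝ≥0∞) (n : ℕ) (s : ℝ) : lipschitzApprox ψ n s ≤ n := by
  have h := ENNReal.toReal_mono (ENNReal.natCast_ne_top n)
    (min_le_right (⨅ t, ψ t + n * edist s t) (n : ℝ≥0∞))
  simpa [lipschitzApprox] using h

theorem ofReal_lipschitzApprox_le (ψ : ℝ → ℝ≥0∞) (n : ℕ) (s : ℝ) :
    ENNReal.ofReal (lipschitzApprox ψ n s) ≤ ψ s := by
  rw [ofReal_lipschitzApprox]
  exact (min_le_left _ _).trans ((iInf_le _ s).trans (by simp))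

theorem lipschitzWith_lipschitzApprox (ψ : ℝ → ℝ≥0∞) (n : ℕ) :
    LipschitzWith n (lipschitzApprox ψ n) := by
  refine LipschitzWith.of_le_add_mul _ fun x y => ?_
  have h : min (⨅ t, ψ t + n * edist x t) (n : ℝ≥0∞) ≤
      min (⨅ t, ψ t + n * edist y t) n + n * edist x y := by
    rw [← min_add_add_right]
    refine min_le_min ?_ le_self_add
    rw [ENNReal.iInf_add]
    refine iInf_mono fun t => ?_
    rw [add_assoc, ← mul_add, add_comm (edist y t)]
    gcongr
    exact edist_triangle _ _ _
  rw [← ofReal_lipschitzApprox, ← ofReal_lipschitzApprox, edist_dist, ← ENNReal.ofReal_natCast,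
    ← ENNReal.ofReal_mul (by positivity),
    ← ENNReal.ofReal_add (lipschitzApprox_nonneg _ _ _) (by positivity)] at h
  have := (ENNReal.ofReal_le_ofReal_iff
    (add_nonneg (lipschitzApprox_nonneg _ _ _) (by positivity))).1 h
  simpa using this

/-- The index and the point move together, as needed for `f_n(u_n)`. For the lower bound, points `t`
near `s` have `ψ t` large by continuity, and points far from `s` pay the penalty `n * edist`. The
argument includes the case `ψ s = ⊤`. -/
theorem tendsto_lipschitzApprox {ψ : ℝ → ℝ≥0∞} (hψ : Continuous ψ) {σ : ℕ → ℕ}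
    (hσ : Tendsto σ atTop atTop) {z : ℕ → ℝ} {s : ℝ} (hz : Tendsto z atTop (𝓝 s)) :
    Tendsto (fun k => ENNReal.ofReal (lipschitzApprox ψ (σ k) (z k))) atTop (𝓝 (ψ s)) := by
  refine tendsto_order.2 ⟨fun M hM => ?_, fun M hM => ?_⟩
  · obtain ⟨M', hM', hM'ψ⟩ := exists_between hM
    have hnear : ∀ᶠ t in 𝓝 s, M' < ψ t := hψ.continuousAt.eventually (lt_mem_nhds hM'ψ)
    obtain ⟨r, hr, hball⟩ := Metric.eventually_nhds_iff.1 hnear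
    have hM'top : M' ≠ ⊤ := (hM'ψ.trans_le le_top).ne
    -- The term `2 / r` makes the penalty at distance `r / 2` exceed `M'`; the term `1` keeps the
    -- truncation height above `M'`.
    obtain ⟨N, hN⟩ := exists_nat_gt (M'.toReal * (1 + 2 / r))
    have h2 : ∀ᶠ y in 𝓝 s, dist y s < r / 2 := Metric.ball_mem_nhds s (half_pos hr)
    filter_upwards [hσ.eventually_ge_atTop N, hz.eventually h2] with k hn hy
    generalize σ k = n at *
    generalize z k = y at *
    rw [ofReal_lipschitzApprox]
    refine hM'.trans_le (le_min (le_iInf fun t => ?_) ?_)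
    · rcases lt_or_ge (dist t s) r with ht | ht
      · exact (hball ht).le.trans le_self_add
      · refine le_trans ?_ le_add_self
        rw [← ENNReal.ofReal_toReal (a := M') hM'top, edist_dist, ← ENNReal.ofReal_natCast,
          ← ENNReal.ofReal_mul (by positivity)]
        refine ENNReal.ofReal_le_ofReal ?_
        have hd : r / 2 ≤ dist y t := by
          have := dist_triangle_left t s y
          linarith
        have hn' : (N : ℝ) ≤ n := by exact_mod_cast hn
        have hM0 : 0 ≤ M'.toReal := ENNReal.toReal_nonneg
        calc M'.toReal ≤ M'.toReal * (1 + 2 / r) * (r / 2) := by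
              field_simp
              nlinarith
          _ ≤ n * dist y t := by
              gcongr
              exact hN.le.trans hn'
    · rw [← ENNReal.ofReal_toReal (a := M') hM'top, ← ENNReal.ofReal_natCast]
      refine ENNReal.ofReal_le_ofReal ?_
      have hn' : (N : ℝ) ≤ n := by exact_mod_cast hn
      have hM0 : 0 ≤ M'.toReal := ENNReal.toReal_nonneg
      have : 0 ≤ M'.toReal * (2 / r) := by positivity
      nlinarith
  · have h2 : ∀ᶠ y in 𝓝 s, ψ y < M := hψ.continuousAt.eventually (gt_mem_nhds hM)
    filter_upwards [hz.eventually h2] with k hk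
    exact (ofReal_lipschitzApprox_le ψ (σ k) (z k)).trans_lt hk

theorem abs_integral_lipschitzApprox_le {ψ : ℝ → ℝ≥0∞} {c₀ c₁ : ℝ} (hc₀ : 0 ≤ c₀) (hc₁ : 0 ≤ c₁)
    (hψ : ∀ R, 0 ≤ R → ∫⁻ t in Icc (-R) R, ψ t ≤ ENNReal.ofReal (c₀ + c₁ * R)) (n : ℕ) (s : ℝ) :
    |∫ t in 0..s, lipschitzApprox ψ n t| ≤ c₀ + c₁ * |s| := by
  have hcont : Continuous (lipschitzApprox ψ n) := (lipschitzWith_lipschitzApprox ψ n).continuous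
  rw [← Real.norm_eq_abs]
  refine (intervalIntegral.norm_integral_le_integral_norm_uIoc).trans ?_
  have hsub : uIoc 0 s ⊆ Icc (-|s|) |s| := by
    intro x hx
    rcases le_total 0 s with h | h
    · rw [uIoc_of_le h] at hx
      rw [abs_of_nonneg h]; exact ⟨by linarith [hx.1], hx.2⟩
    · rw [uIoc_of_ge h] at hx
      rw [abs_of_nonpos h]; exact ⟨by linarith [hx.1], by linarith [hx.2]⟩
  simp_rw [Real.norm_eq_abs, abs_of_nonneg (lipschitzApprox_nonneg ψ n _)]
  rw [integral_eq_lintegral_of_nonneg_ae (ae_of_all _ fun t => lipschitzApprox_nonneg ψ n t)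
    hcont.aestronglyMeasurable]
  refine ENNReal.toReal_le_of_le_ofReal (by positivity) ?_
  calc _ ≤ ∫⁻ t in uIoc 0 s, ψ t := lintegral_mono fun t => ofReal_lipschitzApprox_le ψ n t
    _ ≤ ∫⁻ t in Icc (-|s|) |s|, ψ t := lintegral_mono_set hsub
    _ ≤ _ := hψ _ (abs_nonneg s)

/-! ### Energy estimate -/

/-- The bound on `∫ f(u)²` in `energy_estimate`. -/
noncomputable def energyBound (c₀ c₁ m₀ m₁ T E : ℝ) : ℝ :=
  2 / m₀ * (c₀ + c₁ * m₁ * (T + E) + T * (c₁ ^ 2 * m₁ ^ 2 / m₀) + m₁ ^ 2 / m₀ * E)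

/-- Test the equation with `f(u)`: the chain rule gives `∫ f(u) u' = ∫₀^{u(T)} f ≤ c₀ + c₁ |u(T)|`.
The left side is at least `3/4 m₀ ∫ f(u)²` up to data, while `c₁ |u(T)| ≤ c₁ ∫ |u'|` costs only
`m₀/4 ∫ f(u)²`; half of `m₀ ∫ f(u)²` survives. The bound `C` on `f` does not enter the result, so
the estimate is uniform along the approximations. -/
theorem energy_estimate {f g m u : ℝ → ℝ} {c₀ c₁ m₀ m₁ T C : ℝ} (hT : 0 ≤ T) (hc₁ : 0 ≤ c₁)
    (hm₀ : 0 < m₀) (hf : Continuous f) (hf0 : ∀ s, 0 ≤ f s) (hfC : ∀ s, f s ≤ C)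
    (hfi : ∀ s, |∫ t in 0..s, f t| ≤ c₀ + c₁ * |s|) (hm : Measurable m)
    (hml : ∀ x, m₀ ≤ m x) (hmu : ∀ x, m x ≤ m₁) (hg : MemLp g 2 volume) (hu : Continuous u)
    (hux : ∀ x ∈ Icc 0 T, u x = ∫ t in 0..x, (f (u t) + g t) * m t) :
    ∫ t in 0..T, f (u t) ^ 2 ≤ energyBound c₀ c₁ m₀ m₁ T (∫ t in 0..T, g t ^ 2) := by
  have hm1 : 0 < m₁ := hm₀.trans_le ((hml 0).trans (hmu 0))
  have hmpos : ∀ x, 0 < m x := fun x => hm₀.trans_le (hml x)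
  have hmabs : ∀ x, |m x| ≤ m₁ := fun x => by
    rw [abs_of_pos (hmpos x)]; exact hmu x
  have hgi : IntervalIntegrable g volume 0 T :=
    hg.intervalIntegrable_real 0 T
  have hg2 : IntervalIntegrable (fun t => g t ^ 2) volume 0 T := hg.integrable_sq.intervalIntegrable
  have hfu : Continuous fun t => f (u t) := hf.comp hu
  have hf2 : IntervalIntegrable (fun t => f (u t) ^ 2) volume 0 T :=
    (hfu.pow 2).intervalIntegrable _ _
  have hh : IntervalIntegrable (fun t => (f (u t) + g t) * m t) volume 0 T :=
    ((hfu.intervalIntegrable _ _).add hgi).mul_of_bounded hm hmabs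
  have hchain := intervalIntegral_comp_mul_eq hT hf
    (fun s => by rw [abs_of_nonneg (hf0 s)]; exact hfC s) hh hux
  -- `A` is a pointwise majorant of `c₁ |u'|`, and `B` a pointwise minorant of `f(u) u'`, both from
  -- Young's inequality.
  set A : ℝ → ℝ := fun t =>
    m₀ / 4 * f (u t) ^ 2 + c₁ ^ 2 * m₁ ^ 2 / m₀ + c₁ * m₁ * (1 + g t ^ 2) with hA
  set B : ℝ → ℝ := fun t => 3 / 4 * m₀ * f (u t) ^ 2 - m₁ ^ 2 / m₀ * g t ^ 2 with hB
  have hyoung : ∀ a b : ℝ, a * b ≤ m₀ / 4 * a ^ 2 + b ^ 2 / m₀ := fun a b => by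
    have : m₀ / 4 * a ^ 2 + b ^ 2 / m₀ - a * b = (m₀ * a / 2 - b) ^ 2 / m₀ := by
      field_simp; ring
    have : 0 ≤ (m₀ * a / 2 - b) ^ 2 / m₀ := by positivity
    linarith
  have hAi : IntervalIntegrable A volume 0 T :=
    ((hf2.const_mul _).add intervalIntegrable_const).add
      ((intervalIntegrable_const.add hg2).const_mul _)
  have hBi : IntervalIntegrable B volume 0 T := (hf2.const_mul _).sub (hg2.const_mul _)
  have hfh : IntervalIntegrable (fun t => f (u t) * ((f (u t) + g t) * m t)) volume 0 T :=
    hh.continuousOn_mul hfu.continuousOn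
  have hAle : ∀ t, c₁ * |(f (u t) + g t) * m t| ≤ A t := fun t => by
    have h1 := hyoung (f (u t)) (c₁ * m₁)
    have h2 : |f (u t) + g t| ≤ f (u t) + |g t| := by
      simpa [abs_of_nonneg (hf0 (u t))] using abs_add_le (f (u t)) (g t)
    have h3 : |g t| ≤ 1 + g t ^ 2 := by nlinarith [sq_abs (g t), sq_nonneg (|g t| - 1)]
    calc c₁ * |(f (u t) + g t) * m t| ≤ c₁ * ((f (u t) + (1 + g t ^ 2)) * m₁) := by
          rw [abs_mul]
          have := hf0 (u t)
          refine mul_le_mul_of_nonneg_left (mul_le_mul ?_ (hmabs t) (abs_nonneg _) ?_) hc₁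
          · linarith
          · positivity
      _ = f (u t) * (c₁ * m₁) + c₁ * m₁ * (1 + g t ^ 2) := by ring
      _ ≤ A t := by
          rw [hA, mul_pow] at *
          linarith
  have hBle : ∀ t, B t ≤ f (u t) * ((f (u t) + g t) * m t) := fun t => by
    have h1 := hyoung (f (u t)) (m₁ * |g t|)
    rw [mul_pow, sq_abs] at h1
    have h2 : m₀ * f (u t) ^ 2 ≤ m t * f (u t) ^ 2 := by gcongr; exact hml t
    have h3 : f (u t) * (-g t * m t) ≤ f (u t) * (m₁ * |g t|) := by
      refine mul_le_mul_of_nonneg_left ?_ (hf0 _)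
      rw [mul_comm m₁]
      exact mul_le_mul (neg_le_abs _) (hmu t) (hmpos t).le (abs_nonneg _)
    have h4 : m₁ ^ 2 * g t ^ 2 / m₀ = m₁ ^ 2 / m₀ * g t ^ 2 := by ring
    simp only [hB]
    nlinarith
  have hI1 : ∫ t in 0..T, B t ≤ ∫ t in 0..T, f (u t) * ((f (u t) + g t) * m t) :=
    intervalIntegral.integral_mono hT hBi hfh hBle
  have hI2 : c₁ * |u T| ≤ ∫ t in 0..T, A t := by
    calc c₁ * |u T| ≤ c₁ * ∫ t in 0..T, |(f (u t) + g t) * m t| := by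
          gcongr
          rw [hux T (right_mem_Icc.2 hT)]
          exact intervalIntegral.abs_integral_le_integral_abs hT
      _ = ∫ t in 0..T, c₁ * |(f (u t) + g t) * m t| :=
          (intervalIntegral.integral_const_mul _ _).symm
      _ ≤ _ := intervalIntegral.integral_mono hT (hh.abs.const_mul _) hAi hAle
  have hIA : ∫ t in 0..T, A t = m₀ / 4 * (∫ t in 0..T, f (u t) ^ 2) + T * (c₁ ^ 2 * m₁ ^ 2 / m₀) +
      c₁ * m₁ * (T + ∫ t in 0..T, g t ^ 2) := by
    rw [hA, intervalIntegral.integral_add ((hf2.const_mul _).add intervalIntegrable_const)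
      ((intervalIntegrable_const.add hg2).const_mul _),
      intervalIntegral.integral_add (hf2.const_mul _) intervalIntegrable_const,
      intervalIntegral.integral_const_mul, intervalIntegral.integral_const_mul,
      intervalIntegral.integral_add intervalIntegrable_const hg2]
    rw [intervalIntegral.integral_const, intervalIntegral.integral_const]
    simp
  have hIB : ∫ t in 0..T, B t =
      3 / 4 * m₀ * (∫ t in 0..T, f (u t) ^ 2) - m₁ ^ 2 / m₀ * ∫ t in 0..T, g t ^ 2 := by
    rw [hB, intervalIntegral.integral_sub (hf2.const_mul _) (hg2.const_mul _),
      intervalIntegral.integral_const_mul, intervalIntegral.integral_const_mul]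
  have h5 := (le_abs_self _).trans (hfi (u T))
  rw [hchain] at hI1
  rw [energyBound, div_mul_eq_mul_div, le_div_iff₀ hm₀]
  linarith

/-! ### Compactness and passage to the limit under an `L²` bound -/

theorem exists_subseq_tendsto_of_equicontinuous {u : ℕ → ℝ → ℝ} {T R : ℝ} (hT : 0 ≤ T)
    (hc : ∀ n, Continuous (u n)) (hR : ∀ n, ∀ x ∈ Icc 0 T, |u n x| ≤ R)
    (he : ∀ ε > 0, ∃ δ > 0, ∀ n, ∀ x ∈ Icc 0 T, ∀ y ∈ Icc 0 T, |x - y| < δ →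
      |u n x - u n y| < ε) :
    ∃ v : ℝ → ℝ, Continuous v ∧ ∃ σ : ℕ → ℕ, StrictMono σ ∧
      ∀ x ∈ Icc 0 T, Tendsto (fun k => u (σ k) x) atTop (𝓝 (v x)) := by
  let U : ℕ → BoundedContinuousFunction (Icc 0 T) ℝ := fun n =>
    BoundedContinuousFunction.mkOfCompact ⟨fun x => u n x, (hc n).comp continuous_subtype_val⟩
  have hcomp : IsCompact (closure (range U)) := by
    refine BoundedContinuousFunction.arzela_ascoli (Icc (-R) R) isCompact_Icc _ ?_ ?_
    · rintro _ x ⟨n, rfl⟩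
      exact abs_le.1 (hR n x x.2)
    · intro x₀
      rw [Metric.equicontinuousAt_iff]
      intro ε hε
      obtain ⟨δ, hδ, h⟩ := he ε hε
      refine ⟨δ, hδ, ?_⟩
      rintro x hx ⟨_, n, rfl⟩
      refine h n x₀ x₀.2 x x.2 ?_
      rw [dist_comm] at hx
      exact hx
  obtain ⟨w, -, σ, hσ, hw⟩ := hcomp.tendsto_subseq fun n => subset_closure (mem_range_self n)
  refine ⟨IccExtend hT w, w.continuous.Icc_extend', σ, hσ, fun x hx => ?_⟩
  rw [IccExtend_of_mem hT w hx]
  exact ((BoundedContinuousFunction.lipschitz_eval_const (⟨x, hx⟩ : Icc 0 T)).continuous.tendsto w).comp hw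

theorem lintegral_sq_le_of_tendsto {α : Type*} [MeasurableSpace α] {μ : Measure α}
    {P : ℕ → α → ℝ≥0∞} {Q : α → ℝ≥0∞} {B : ℝ≥0∞} (hP : ∀ n, Measurable (P n))
    (hlim : ∀ᵐ x ∂μ, Tendsto (fun n => P n x) atTop (𝓝 (Q x)))
    (hB : ∀ n, ∫⁻ x, P n x ^ 2 ∂μ ≤ B) : ∫⁻ x, Q x ^ 2 ∂μ ≤ B := by
  calc ∫⁻ x, Q x ^ 2 ∂μ = ∫⁻ x, liminf (fun n => P n x ^ 2) atTop ∂μ := by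
        refine lintegral_congr_ae ?_
        filter_upwards [hlim] with x hx
        exact (((ENNReal.continuous_pow 2).tendsto _).comp hx).liminf_eq.symm
    _ ≤ liminf (fun n => ∫⁻ x, P n x ^ 2 ∂μ) atTop :=
        lintegral_liminf_le fun n => (hP n).pow_const 2
    _ ≤ B := liminf_le_of_frequently_le' (Frequently.of_forall hB)

/-- An `L²` bound on a finite measure space gives uniform integrability: `P ≤ min P M + P² / M`,
where the truncated part converges by domination and the rest is at most `B / M`. -/
theorem tendsto_lintegral_of_sq_bounded {α : Type*} [MeasurableSpace α] {μ : Measure α}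
    [IsFiniteMeasure μ] {P : ℕ → α → ℝ≥0∞} {Q : α → ℝ≥0∞} {B : ℝ≥0∞} (hBtop : B ≠ ⊤)
    (hP : ∀ n, Measurable (P n))
    (hlim : ∀ᵐ x ∂μ, Tendsto (fun n => P n x) atTop (𝓝 (Q x)))
    (hB : ∀ n, ∫⁻ x, P n x ^ 2 ∂μ ≤ B) :
    Tendsto (fun n => ∫⁻ x, P n x ∂μ) atTop (𝓝 (∫⁻ x, Q x ∂μ)) := by
  refine tendsto_of_le_liminf_of_limsup_le ?_ ?_
  · calc ∫⁻ x, Q x ∂μ = ∫⁻ x, liminf (fun n => P n x) atTop ∂μ := by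
          refine lintegral_congr_ae ?_
          filter_upwards [hlim] with x hx
          exact hx.liminf_eq.symm
      _ ≤ _ := lintegral_liminf_le hP
  · have key : ∀ M : ℕ, limsup (fun n => ∫⁻ x, P n x ∂μ) atTop ≤ ∫⁻ x, Q x ∂μ + (M : ℝ≥0∞)⁻¹ * B := by
      intro M
      have hmin : Tendsto (fun n => ∫⁻ x, min (P n x) M ∂μ) atTop (𝓝 (∫⁻ x, min (Q x) M ∂μ)) := by
        refine tendsto_lintegral_of_dominated_convergence (fun _ => (M : ℝ≥0∞))
          (fun n => (hP n).min measurable_const) (fun n => ae_of_all _ fun x => min_le_right _ _) ?_ ?_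
        · rw [lintegral_const]
          exact ENNReal.mul_ne_top (ENNReal.natCast_ne_top M) (measure_ne_top μ _)
        · filter_upwards [hlim] with x hx
          exact hx.min tendsto_const_nhds
      have hle : ∀ n, ∫⁻ x, P n x ∂μ ≤ ∫⁻ x, min (P n x) M ∂μ + (M : ℝ≥0∞)⁻¹ * B := by
        intro n
        calc ∫⁻ x, P n x ∂μ ≤ ∫⁻ x, (min (P n x) M + (M : ℝ≥0∞)⁻¹ * P n x ^ 2) ∂μ := by
              refine lintegral_mono fun x => ?_
              rcases le_total (P n x) M with h | h
              · rw [min_eq_left h]; exact le_self_add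
              · refine le_trans ?_ le_add_self
                rcases eq_or_ne M 0 with rfl | hM
                · rcases eq_or_ne (P n x) 0 with h0 | h0
                  · simp [h0]
                  · simp [ENNReal.top_mul, h0]
                · calc P n x = (M : ℝ≥0∞)⁻¹ * M * P n x := by
                        rw [ENNReal.inv_mul_cancel (by exact_mod_cast hM)
                          (ENNReal.natCast_ne_top M), one_mul]
                    _ ≤ (M : ℝ≥0∞)⁻¹ * P n x * P n x := by gcongr
                    _ = _ := by ring
          _ = ∫⁻ x, min (P n x) M ∂μ + (M : ℝ≥0∞)⁻¹ * ∫⁻ x, P n x ^ 2 ∂μ := by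
              rw [lintegral_add_left ((hP n).min measurable_const),
                lintegral_const_mul _ ((hP n).pow_const 2)]
          _ ≤ _ := by gcongr; exact hB n
      calc limsup (fun n => ∫⁻ x, P n x ∂μ) atTop
          ≤ limsup (fun n => ∫⁻ x, min (P n x) M ∂μ + (M : ℝ≥0∞)⁻¹ * B) atTop :=
            limsup_le_limsup (Eventually.of_forall hle)
        _ = ∫⁻ x, min (Q x) M ∂μ + (M : ℝ≥0∞)⁻¹ * B := (hmin.add tendsto_const_nhds).limsup_eq
        _ ≤ _ := by gcongr; exact min_le_left _ _
    have hM : Tendsto (fun M : ℕ => ∫⁻ x, Q x ∂μ + (M : ℝ≥0∞)⁻¹ * B) atTop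
        (𝓝 (∫⁻ x, Q x ∂μ + 0 * B)) :=
      tendsto_const_nhds.add
        (ENNReal.Tendsto.mul_const ENNReal.tendsto_inv_nat_nhds_zero (Or.inr hBtop))
    rw [zero_mul, add_zero] at hM
    exact ge_of_tendsto' hM key

/-- The Cauchy–Schwarz estimate in Young form, `|p| ≤ l p² + 1 / (4 l)`. The free parameter `l` is
what yields equicontinuity from an `L²` bound on derivatives. -/
theorem abs_intervalIntegral_le_of_sq {p : ℝ → ℝ} {T l x y : ℝ} (hl : 0 < l) (hx : 0 ≤ x)
    (hxy : x ≤ y) (hy : y ≤ T) (hp : IntervalIntegrable p volume 0 T)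
    (hp2 : IntervalIntegrable (fun t => p t ^ 2) volume 0 T) :
    |∫ t in x..y, p t| ≤ l * (∫ t in 0..T, p t ^ 2) + (y - x) / (4 * l) := by
  have hsub : uIcc x y ⊆ uIcc 0 T := by
    rw [uIcc_of_le hxy, uIcc_of_le (hx.trans (hxy.trans hy))]
    exact Icc_subset_Icc hx hy
  have h2 := hp2.mono_set hsub
  calc |∫ t in x..y, p t| ≤ ∫ t in x..y, |p t| := intervalIntegral.abs_integral_le_integral_abs hxy
    _ ≤ ∫ t in x..y, (l * p t ^ 2 + 1 / (4 * l)) := by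
        refine intervalIntegral.integral_mono hxy (hp.mono_set hsub).abs
          ((h2.const_mul l).add intervalIntegrable_const) fun t => ?_
        have h : l * p t ^ 2 + 1 / (4 * l) - |p t| = (2 * l * |p t| - 1) ^ 2 / (4 * l) := by
          rw [← sq_abs]; field_simp; ring
        have : 0 ≤ (2 * l * |p t| - 1) ^ 2 / (4 * l) := by positivity
        simp only
        linarith
    _ = l * (∫ t in x..y, p t ^ 2) + (y - x) / (4 * l) := by
        rw [intervalIntegral.integral_add (h2.const_mul l) intervalIntegrable_const,
          intervalIntegral.integral_const_mul, intervalIntegral.integral_const]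
        simp [div_eq_mul_inv]
    _ ≤ _ := by
        gcongr
        exact intervalIntegral.integral_mono_interval hx hxy hy
          (ae_of_all _ fun t => sq_nonneg (p t)) hp2

/-! ### The singular first-order equation -/

theorem exists_convergent_approximations {ψ : ℝ → ℝ≥0∞} {c₀ c₁ : ℝ}
    (hc₀ : 0 ≤ c₀) (hc₁ : 0 ≤ c₁)
    (hψi : ∀ R, 0 ≤ R → ∫⁻ t in Icc (-R) R, ψ t ≤ ENNReal.ofReal (c₀ + c₁ * R))
    {m : ℝ → ℝ} {m₀ m₁ : ℝ} (hm : Measurable m) (hm₀ : 0 < m₀) (hml : ∀ x, m₀ ≤ m x)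
    (hmu : ∀ x, m x ≤ m₁) {g : ℝ → ℝ} (hg : MemLp g 2 volume) {T : ℝ} (hT : 0 ≤ T) :
    ∃ (B : ℝ) (u : ℕ → ℝ → ℝ) (v : ℝ → ℝ) (σ : ℕ → ℕ), (∀ n, Continuous (u n)) ∧ Continuous v ∧
      StrictMono σ ∧ (∀ x ∈ Icc 0 T, Tendsto (fun k => u (σ k) x) atTop (𝓝 (v x))) ∧
      (∀ n, ∀ x ∈ Icc 0 T, u n x = (∫ t in 0..x, g t * m t) +
        ∫ t in 0..x, lipschitzApprox ψ n (u n t) * m t) ∧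
      ∀ n, ∫ t in 0..T, lipschitzApprox ψ n (u n t) ^ 2 ≤ B := by
  have hmpos : ∀ x, 0 < m x := fun x => hm₀.trans_le (hml x)
  have hmabs : ∀ x, |m x| ≤ m₁ := fun x => by
    rw [abs_of_pos (hmpos x)]; exact hmu x
  have hgm : ∀ a b, IntervalIntegrable (fun t => g t * m t) volume a b := fun a b =>
    (hg.intervalIntegrable_real a b).mul_of_bounded hm hmabs
  have hG : Continuous fun x => ∫ t in 0..x, g t * m t :=
    intervalIntegral.continuous_primitive hgm 0
  choose u huc hux using fun n : ℕ =>
    exists_volterra_solution hT (lipschitzWith_lipschitzApprox ψ n) hm hmabs hG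
  set F : ℕ → ℝ → ℝ := fun n t => lipschitzApprox ψ n (u n t) with hF
  have hFc : ∀ n, Continuous (F n) := fun n =>
    (lipschitzWith_lipschitzApprox ψ n).continuous.comp (huc n)
  have hFm : ∀ n a b, IntervalIntegrable (fun t => F n t * m t) volume a b := fun n a b =>
    ((hFc n).intervalIntegrable a b).mul_of_bounded hm hmabs
  have hux' : ∀ n, ∀ x ∈ Icc 0 T, u n x = ∫ t in 0..x, (F n t + g t) * m t := fun n x hx => by
    rw [hux n x hx, add_comm, ← intervalIntegral.integral_add (hFm n 0 x) (hgm 0 x)]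
    simp only [add_mul, hF]
  set E := ∫ t in 0..T, g t ^ 2 with hE
  set B := energyBound c₀ c₁ m₀ m₁ T E with hB
  have hen : ∀ n, ∫ t in 0..T, F n t ^ 2 ≤ B := fun n =>
    energy_estimate (f := lipschitzApprox ψ n) hT hc₁ hm₀ (lipschitzWith_lipschitzApprox ψ n).continuous
      (lipschitzApprox_nonneg ψ n) (lipschitzApprox_le ψ n)
      (abs_integral_lipschitzApprox_le hc₀ hc₁ hψi n) hm hml hmu hg (huc n) (hux' n)
  have hg2 : IntervalIntegrable (fun t => g t ^ 2) volume 0 T := hg.integrable_sq.intervalIntegrable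
  have hF2 : ∀ n, IntervalIntegrable (fun t => F n t ^ 2) volume 0 T := fun n =>
    ((hFc n).pow 2).intervalIntegrable _ _
  have hh : ∀ n a b, IntervalIntegrable (fun t => (F n t + g t) * m t) volume a b := fun n a b =>
    (((hFc n).intervalIntegrable a b).add (hg.intervalIntegrable_real a b)).mul_of_bounded hm hmabs
  have hhle : ∀ n t, ((F n t + g t) * m t) ^ 2 ≤ 2 * m₁ ^ 2 * (F n t ^ 2 + g t ^ 2) := fun n t => by
    have h1 : (F n t + g t) ^ 2 ≤ 2 * (F n t ^ 2 + g t ^ 2) := by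
      nlinarith [sq_nonneg (F n t - g t)]
    have h2 : m t ^ 2 ≤ m₁ ^ 2 := by
      have := (hmpos t).le
      gcongr
      exact hmu t
    calc ((F n t + g t) * m t) ^ 2 = (F n t + g t) ^ 2 * m t ^ 2 := mul_pow _ _ _
      _ ≤ 2 * (F n t ^ 2 + g t ^ 2) * m₁ ^ 2 := by gcongr
      _ = _ := by ring
  have hh2 : ∀ n, IntervalIntegrable (fun t => ((F n t + g t) * m t) ^ 2) volume 0 T := fun n => by
    refine (((hF2 n).add hg2).const_mul (2 * m₁ ^ 2)).mono_fun ?_ (ae_of_all _ fun t => ?_)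
    · exact (intervalIntegrable_iff.1 (hh n 0 T)).aestronglyMeasurable.pow 2
    · simp only [Real.norm_eq_abs]
      rw [abs_of_nonneg (sq_nonneg _)]
      exact (hhle n t).trans (le_abs_self _)
  set Q := 2 * m₁ ^ 2 * (B + E) with hQ
  have hhQ : ∀ n, ∫ t in 0..T, ((F n t + g t) * m t) ^ 2 ≤ Q := fun n => by
    calc _ ≤ ∫ t in 0..T, 2 * m₁ ^ 2 * (F n t ^ 2 + g t ^ 2) :=
          intervalIntegral.integral_mono hT (hh2 n) (((hF2 n).add hg2).const_mul _) (hhle n)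
      _ = 2 * m₁ ^ 2 * ((∫ t in 0..T, F n t ^ 2) + E) := by
          rw [intervalIntegral.integral_const_mul, intervalIntegral.integral_add (hF2 n) hg2]
      _ ≤ _ := by rw [hQ]; gcongr; exact hen n
  have hmod : ∀ n, ∀ l > 0, ∀ x ∈ Icc 0 T, ∀ y ∈ Icc 0 T,
      |u n x - u n y| ≤ l * Q + |x - y| / (4 * l) := by
    intro n l hl x hx y hy
    wlog hxy : x ≤ y generalizing x y
    · rw [abs_sub_comm (u n x), abs_sub_comm x]
      exact this y hy x hx (le_of_not_ge hxy)
    rw [abs_sub_comm (u n x), abs_sub_comm x, abs_of_nonneg (sub_nonneg.2 hxy), hux' n x hx,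
      hux' n y hy, intervalIntegral.integral_interval_sub_left (hh n _ _) (hh n _ _)]
    refine (abs_intervalIntegral_le_of_sq hl hx.1 hxy hy.2 (hh n 0 T) (hh2 n)).trans ?_
    gcongr
    exact hhQ n
  have hQ0 : 0 ≤ Q := by
    have := hhQ 0
    exact (intervalIntegral.integral_nonneg hT fun t _ => sq_nonneg _).trans this
  have hu0 : ∀ n, u n 0 = 0 := fun n => by rw [hux' n 0 ⟨le_rfl, hT⟩]; simp
  obtain ⟨v, hvc, σ, hσ, hv⟩ := exists_subseq_tendsto_of_equicontinuous (R := Q + T / 4) hT huc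
    (fun n x hx => by
      have h := hmod n 1 one_pos x hx 0 ⟨le_rfl, hT⟩
      rw [hu0, sub_zero, sub_zero, abs_of_nonneg hx.1] at h
      linarith [hx.2])
    (fun ε hε => by
      -- This `l` makes `l * Q < ε / 2`; then `|x - y| < 2 * l * ε` makes the other term less than
      -- `ε / 2`.
      set l := ε / (2 * (Q + 1)) with hl
      have hl0 : 0 < l := by positivity
      refine ⟨2 * l * ε, by positivity, fun n x hx y hy hxy => ?_⟩
      refine (hmod n l hl0 x hx y hy).trans_lt ?_
      have h1 : l * Q < ε / 2 := by
        rw [hl, div_mul_eq_mul_div, div_lt_div_iff₀ (by positivity) two_pos]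
        nlinarith
      have h2 : |x - y| / (4 * l) < ε / 2 := by
        rw [div_lt_div_iff₀ (by positivity) two_pos]
        linarith
      linarith)
  exact ⟨B, u, v, σ, huc, hvc, hσ, hv, hux, hen⟩

/-- Fatou's lemma bounds `ψ(v)` in `L²`, so the limit `v` meets the set `ψ = ⊤` only at a null set
of times, and `p` is the resulting real-valued version of `ψ(v)`. Uniform integrability then carries
the integral equation to the limit. -/
theorem exists_singular_ode_solution {ψ : ℝ → ℝ≥0∞} (hψ : Continuous ψ) {c₀ c₁ : ℝ}
    (hc₀ : 0 ≤ c₀) (hc₁ : 0 ≤ c₁)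
    (hψi : ∀ R, 0 ≤ R → ∫⁻ t in Icc (-R) R, ψ t ≤ ENNReal.ofReal (c₀ + c₁ * R))
    {m : ℝ → ℝ} {m₀ m₁ : ℝ} (hm : Measurable m) (hm₀ : 0 < m₀) (hml : ∀ x, m₀ ≤ m x)
    (hmu : ∀ x, m x ≤ m₁) {g : ℝ → ℝ} (hg : MemLp g 2 volume) {T : ℝ} (hT : 0 ≤ T) :
    ∃ u p : ℝ → ℝ, Continuous u ∧ MemLp p 2 volume ∧ (∀ x, 0 ≤ p x) ∧
      (∀ᵐ x, x ∈ Icc 0 T → ψ (u x) = ENNReal.ofReal (p x)) ∧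
      ∀ x ∈ Icc 0 T, u x = ∫ t in 0..x, (p t + g t) * m t := by
  have hmpos : ∀ x, 0 < m x := fun x => hm₀.trans_le (hml x)
  have hmabs : ∀ x, |m x| ≤ m₁ := fun x => by
    rw [abs_of_pos (hmpos x)]; exact hmu x
  have hgm : ∀ a b, IntervalIntegrable (fun t => g t * m t) volume a b := fun a b =>
    (hg.intervalIntegrable_real a b).mul_of_bounded hm hmabs
  obtain ⟨B, u, v, σ, huc, hvc, hσ, hv, hux, hen⟩ :=
    exists_convergent_approximations hc₀ hc₁ hψi hm hm₀ hml hmu hg hT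
  set F : ℕ → ℝ → ℝ := fun n t => lipschitzApprox ψ n (u n t) with hF
  have hFc : ∀ n, Continuous (F n) := fun n =>
    (lipschitzWith_lipschitzApprox ψ n).continuous.comp (huc n)
  have hF0 : ∀ n t, 0 ≤ F n t := fun n t => lipschitzApprox_nonneg ψ n _
  have hFm : ∀ n a b, IntervalIntegrable (fun t => F n t * m t) volume a b := fun n a b =>
    ((hFc n).intervalIntegrable a b).mul_of_bounded hm hmabs
  have hFψ : ∀ t ∈ Icc 0 T,
      Tendsto (fun k => ENNReal.ofReal (F (σ k) t)) atTop (𝓝 (ψ (v t))) := fun t ht => by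
    simp only [hF]
    exact tendsto_lipschitzApprox hψ hσ.tendsto_atTop (hv t ht)
  have hFE : ∀ n, ∫⁻ t in Icc 0 T, ENNReal.ofReal (F n t) ^ 2 ≤ ENNReal.ofReal B := fun n => by
    have h1 : ∫⁻ t in Icc 0 T, ENNReal.ofReal (F n t) ^ 2 =
        ENNReal.ofReal (∫ t in 0..T, F n t ^ 2) := by
      rw [intervalIntegral.integral_of_le hT, ← integral_Icc_eq_integral_Ioc,
        ofReal_integral_eq_lintegral_ofReal (f := fun t => F n t ^ 2)
          (((hFc n).pow 2).continuousOn.integrableOn_compact isCompact_Icc)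
          (ae_of_all _ fun t => sq_nonneg _)]
      exact lintegral_congr fun t => (ENNReal.ofReal_pow (hF0 n t) 2).symm
    rw [h1]
    exact ENNReal.ofReal_le_ofReal (hen n)
  have hψvm : Measurable fun t => ψ (v t) := (hψ.comp hvc).measurable
  have hFmeas : ∀ n, Measurable fun t => ENNReal.ofReal (F n t) := fun n =>
    (hFc n).measurable.ennreal_ofReal
  have hψv2 : ∫⁻ t in Icc 0 T, ψ (v t) ^ 2 ≤ ENNReal.ofReal B :=
    lintegral_sq_le_of_tendsto (fun k => hFmeas (σ k))
      ((ae_restrict_iff' measurableSet_Icc).2 (ae_of_all _ hFψ)) fun k => hFE (σ k)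
  have hfin : ∀ᵐ t ∂(volume.restrict (Icc 0 T)), ψ (v t) ≠ ⊤ := by
    filter_upwards [ae_lt_top (hψvm.pow_const 2) (hψv2.trans_lt ENNReal.ofReal_lt_top).ne] with t ht h
    simp [h] at ht
  set p : ℝ → ℝ := (Icc 0 T).indicator fun t => (ψ (v t)).toReal with hp
  have hpψ : ∀ᵐ t, t ∈ Icc 0 T → ψ (v t) = ENNReal.ofReal (p t) := by
    filter_upwards [(ae_restrict_iff' measurableSet_Icc).1 hfin] with t ht hI
    rw [hp, indicator_of_mem hI, ENNReal.ofReal_toReal (ht hI)]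
  have hp0 : ∀ t, 0 ≤ p t := fun t => indicator_nonneg (fun _ _ => ENNReal.toReal_nonneg) t
  have hpL : MemLp p 2 volume := by
    rw [hp, memLp_indicator_iff_restrict measurableSet_Icc,
      memLp_two_iff_integrable_sq hψvm.ennreal_toReal.aestronglyMeasurable]
    refine ⟨(hψvm.ennreal_toReal.pow_const 2).aestronglyMeasurable, ?_⟩
    rw [hasFiniteIntegral_iff_ofReal (ae_of_all _ fun t => sq_nonneg _)]
    refine lt_of_le_of_lt (lintegral_mono fun t => ?_) (hψv2.trans_lt ENNReal.ofReal_lt_top)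
    rw [ENNReal.ofReal_pow ENNReal.toReal_nonneg]
    gcongr
    exact ENNReal.ofReal_toReal_le
  refine ⟨v, p, hvc, hpL, hp0, hpψ, fun x hx => ?_⟩
  have hsub : Ioc 0 x ⊆ Icc 0 T := fun t ht => ⟨ht.1.le, ht.2.trans hx.2⟩
  have hmm : Measurable fun t => ENNReal.ofReal (m t) := hm.ennreal_ofReal
  have hmtop : ENNReal.ofReal m₁ ≠ ⊤ := ENNReal.ofReal_ne_top
  have hBd : ∀ n, ∫⁻ t in Ioc 0 x, (ENNReal.ofReal (F n t) * ENNReal.ofReal (m t)) ^ 2 ≤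
      ENNReal.ofReal m₁ ^ 2 * ENNReal.ofReal B := fun n => by
    calc _ ≤ ∫⁻ t in Ioc 0 x, ENNReal.ofReal m₁ ^ 2 * ENNReal.ofReal (F n t) ^ 2 := by
          refine lintegral_mono fun t => ?_
          simp only
          rw [mul_pow, mul_comm]
          gcongr
          exact hmu t
      _ = ENNReal.ofReal m₁ ^ 2 * ∫⁻ t in Ioc 0 x, ENNReal.ofReal (F n t) ^ 2 :=
          lintegral_const_mul _ ((hFmeas n).pow_const 2)
      _ ≤ _ := by
          gcongr
          exact (lintegral_mono_set hsub).trans (hFE n)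
  have hlim := tendsto_lintegral_of_sq_bounded (μ := volume.restrict (Ioc 0 x))
    (P := fun k t => ENNReal.ofReal (F (σ k) t) * ENNReal.ofReal (m t))
    (Q := fun t => ψ (v t) * ENNReal.ofReal (m t))
    (ENNReal.mul_ne_top (ENNReal.pow_ne_top hmtop) ENNReal.ofReal_ne_top)
    (fun k => (hFmeas (σ k)).mul hmm)
    ((ae_restrict_iff' measurableSet_Ioc).2 (ae_of_all _ fun t ht =>
      ENNReal.Tendsto.mul_const (hFψ t (hsub ht)) (Or.inr ENNReal.ofReal_ne_top)))
    (fun k => hBd (σ k))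
  have hpmi : IntervalIntegrable (fun t => p t * m t) volume 0 x :=
    (hpL.intervalIntegrable_real 0 x).mul_of_bounded hm hmabs
  have hpm0 : ∀ t, 0 ≤ p t * m t := fun t => mul_nonneg (hp0 t) (hmpos t).le
  have hcongr : ∫⁻ t in Ioc 0 x, ψ (v t) * ENNReal.ofReal (m t) =
      ∫⁻ t in Ioc 0 x, ENNReal.ofReal (p t * m t) := by
    refine lintegral_congr_ae ((ae_restrict_iff' measurableSet_Ioc).2 ?_)
    filter_upwards [hpψ] with t ht hI
    rw [ht (hsub hI), ENNReal.ofReal_mul (hp0 t)]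
  have hR : ∀ q : ℝ → ℝ, IntervalIntegrable q volume 0 x → (∀ t, 0 ≤ q t) →
      ∫⁻ t in Ioc 0 x, ENNReal.ofReal (q t) = ENNReal.ofReal (∫ t in 0..x, q t) := by
    intro q hq hq0
    rw [intervalIntegral.integral_of_le hx.1, ofReal_integral_eq_lintegral_ofReal hq.1
      (ae_of_all _ hq0)]
  rw [hcongr, hR _ hpmi hpm0] at hlim
  have hlim' : Tendsto (fun k => ∫ t in 0..x, F (σ k) t * m t) atTop
      (𝓝 (∫ t in 0..x, p t * m t)) := by
    have h := (ENNReal.tendsto_toReal ENNReal.ofReal_ne_top).comp hlim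
    rw [ENNReal.toReal_ofReal (intervalIntegral.integral_nonneg hx.1 fun t _ => hpm0 t)] at h
    refine h.congr fun k => ?_
    have h3 : ∀ t, 0 ≤ F (σ k) t * m t := fun t => mul_nonneg (hF0 _ t) (hmpos t).le
    simp only [Function.comp, ← ENNReal.ofReal_mul (hF0 (σ k) _)]
    rw [hR _ (hFm (σ k) 0 x) h3,
      ENNReal.toReal_ofReal (intervalIntegral.integral_nonneg hx.1 fun t _ => h3 t)]
  have hlim2 : Tendsto (fun k => u (σ k) x) atTop
      (𝓝 ((∫ t in 0..x, p t * m t) + ∫ t in 0..x, g t * m t)) :=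
    (hlim'.add_const (∫ t in 0..x, g t * m t)).congr fun k => by
      rw [hux (σ k) x hx, add_comm]
  rw [tendsto_nhds_unique (hv x hx) hlim2, ← intervalIntegral.integral_add hpmi (hgm 0 x)]
  simp only [add_mul]

/-! ### Weak formulation, shift of the nonlinearity, inverse coefficient -/

instance (L : ℝ) : IsFiniteMeasure (intervalMeasure L) := by
  unfold intervalMeasure; infer_instance

theorem IsTestFunction.deriv_bounded {L : ℝ} {η : ℝ → ℝ} (hη : IsTestFunction L η) :
    ∃ C, ∀ x, ‖deriv η x‖ ≤ C :=
  (hη.smooth.continuous_deriv (by simp)).bounded_above_of_compact_support hη.compact.deriv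

theorem IsTestFunction.integrable_mul_deriv {L : ℝ} {η f : ℝ → ℝ} (hη : IsTestFunction L η)
    (hf : MemLp f 2 (intervalMeasure L)) :
    Integrable (fun x => f x * deriv η x) (intervalMeasure L) := by
  obtain ⟨C, hC⟩ := hη.deriv_bounded
  exact (hf.integrable one_le_two).mul_bdd
    (hη.smooth.continuous_deriv (by simp)).aestronglyMeasurable (ae_of_all _ hC)

theorem isWeakDeriv_of_eq_integral {L : ℝ} (hL : 0 ≤ L) {u h : ℝ → ℝ}
    (hh : IntervalIntegrable h volume 0 L) (hu : ∀ x ∈ Icc 0 L, u x = ∫ t in 0..x, h t) :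
    IsWeakDeriv L u h := by
  intro η hη
  set U : ℝ → ℝ := fun x => ∫ t in 0..x, h t
  have hUac : AbsolutelyContinuousOnInterval U 0 L :=
    hh.absolutelyContinuousOnInterval_intervalIntegral left_mem_uIcc
  have hηac : AbsolutelyContinuousOnInterval η 0 L :=
    (hη.smooth.of_le (by simp)).contDiffOn.absolutelyContinuousOnInterval
  have hη0 : η 0 = 0 := image_eq_zero_of_notMem_tsupport fun h => lt_irrefl _ (hη.support h).1
  have hηL : η L = 0 := image_eq_zero_of_notMem_tsupport fun h => lt_irrefl _ (hη.support h).2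
  have key := hUac.integral_mul_deriv_eq_deriv_mul hηac
  rw [hη0, hηL, mul_zero, mul_zero, sub_zero, zero_sub] at key
  have hconv : ∀ F : ℝ → ℝ, ∫ x, F x ∂(intervalMeasure L) = ∫ x in 0..L, F x := fun F => by
    rw [intervalIntegral.integral_of_le hL, integral_Ioc_eq_integral_Ioo]; rfl
  rw [hconv, hconv]
  have h1 : ∫ x in 0..L, u x * deriv η x = ∫ x in 0..L, U x * deriv η x :=
    intervalIntegral.integral_congr fun x hx => by
      rw [uIcc_of_le hL] at hx
      simp only [hu x hx, U]
  have h2 : ∫ x in 0..L, deriv U x * η x = ∫ x in 0..L, h x * η x := by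
    refine intervalIntegral.integral_congr_ae ?_
    filter_upwards [hh.ae_hasDerivAt_integral] with x hx hxL
    rw [(hx (uIoc_subset_uIcc hxL) 0 left_mem_uIcc).deriv]
  rw [h1, key, h2]

/-- On `[-1, 1]` the minimum is attained and is not `⊥`; outside, `φ` is bounded. -/
theorem IsNonlinearity.exists_lower_bound {φ : ℝ → EReal} (hφ : IsNonlinearity φ)
    (hφb : IsBoundedAwayFromZero φ) : ∃ K : ℝ, 0 ≤ K ∧ ∀ s, ((-K : ℝ) : EReal) ≤ φ s := by
  obtain ⟨s₀, -, hs₀⟩ := (isCompact_Icc (a := (-1 : ℝ)) (b := 1)).exists_isMinOn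
    ⟨0, by norm_num⟩ hφ.continuous.continuousOn
  obtain ⟨r, -, hr⟩ := EReal.lt_iff_exists_real_btwn.1 (bot_lt_iff_ne_bot.2 (hφ.ne_bot s₀))
  obtain ⟨C, hC⟩ := hφb 1 one_pos
  refine ⟨max |r| C, (abs_nonneg r).trans (le_max_left _ _), fun s => ?_⟩
  rcases le_total |s| 1 with h | h
  · refine le_trans ?_ (hr.le.trans (hs₀ (abs_le.1 h)))
    exact EReal.coe_le_coe_iff.2 (by linarith [le_max_left |r| C, neg_abs_le r])
  · have hs : s ≠ 0 := by rintro rfl; norm_num at h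
    rw [← EReal.coe_toReal (hφ.ne_top s hs) (hφ.ne_bot s)]
    exact EReal.coe_le_coe_iff.2 (by linarith [le_max_right |r| C, (abs_le.1 (hC s h)).1])

/-- The nonnegative shift `φ + K` of `φ`, with values in `[0, ∞]`. -/
noncomputable def shiftedNonlinearity (φ : ℝ → EReal) (K : ℝ) (s : ℝ) : ℝ≥0∞ :=
  (φ s + (K : EReal)).toENNReal

theorem continuous_shiftedNonlinearity {φ : ℝ → EReal} (hφ : Continuous φ) (K : ℝ) :
    Continuous (shiftedNonlinearity φ K) := by
  refine EReal.continuous_toENNReal.comp (continuous_iff_continuousAt.2 fun s => ?_)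
  have h := EReal.continuousAt_add (p := (φ s, (K : EReal))) (Or.inr (by simp)) (Or.inr (by simp))
  exact ContinuousAt.comp (f := fun s => (φ s, (K : EReal))) h
    (hφ.prodMk continuous_const).continuousAt

theorem shiftedNonlinearity_of_top {φ : ℝ → EReal} (K : ℝ) {s : ℝ} (hs : φ s = ⊤) :
    shiftedNonlinearity φ K s = ⊤ := by
  simp [shiftedNonlinearity, hs]

theorem shiftedNonlinearity_eq {φ : ℝ → EReal} (K : ℝ) {s : ℝ} (hs : φ s ≠ ⊤) (hs' : φ s ≠ ⊥) :
    shiftedNonlinearity φ K s = ENNReal.ofReal ((φ s).toReal + K) := by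
  rw [shiftedNonlinearity]
  conv_lhs => rw [← EReal.coe_toReal hs hs', ← EReal.coe_add]
  rw [EReal.toENNReal_of_ne_top (EReal.coe_ne_top _), EReal.toReal_coe]

theorem toReal_eq_of_shiftedNonlinearity_eq {φ : ℝ → EReal} {K s p : ℝ} (hp : 0 ≤ p)
    (hK : ((-K : ℝ) : EReal) ≤ φ s) (h : shiftedNonlinearity φ K s = ENNReal.ofReal p) :
    (φ s ≠ ⊤ ∧ φ s ≠ ⊥) ∧ (φ s).toReal = p - K := by
  have h1 : φ s ≠ ⊤ := fun h' => by
    rw [shiftedNonlinearity_of_top K h'] at h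
    exact ENNReal.ofReal_ne_top h.symm
  have h2 : φ s ≠ ⊥ := fun h' => by
    rw [h'] at hK
    exact EReal.coe_ne_bot _ (le_bot_iff.1 hK)
  refine ⟨⟨h1, h2⟩, ?_⟩
  rw [shiftedNonlinearity_eq K h1 h2] at h
  rw [← EReal.coe_toReal h1 h2, EReal.coe_le_coe_iff] at hK
  have := (ENNReal.ofReal_eq_ofReal_iff (by linarith) hp).1 h
  linarith

/-- The singularity at `0` contributes a fixed finite amount `c₀`, and the bounded part contributes
in proportion to the length `2 R`. This linear growth is what `energy_estimate` requires. -/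
theorem exists_lintegral_shiftedNonlinearity_le {φ : ℝ → EReal} (hφ : IsNonlinearity φ)
    (hφi : IsIntegrableNearZero φ) (hφb : IsBoundedAwayFromZero φ) (K : ℝ) :
    ∃ c₀ c₁ : ℝ, 0 ≤ c₀ ∧ 0 ≤ c₁ ∧ ∀ R, 0 ≤ R →
      ∫⁻ t in Icc (-R) R, shiftedNonlinearity φ K t ≤ ENNReal.ofReal (c₀ + c₁ * R) := by
  obtain ⟨C, hC⟩ := hφb (1 / 2) (by norm_num)
  set D : ℝ := |C + K| with hD
  set S : Set ℝ := Ioo (-(1 / 2)) 0 ∪ Ioo 0 (1 / 2) with hS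
  have hSm : MeasurableSet S := measurableSet_Ioo.union measurableSet_Ioo
  obtain ⟨hi₁, hi₂⟩ := hφi (1 / 2) (by norm_num) (by norm_num)
  have hSi : IntegrableOn (fun t => (φ t).toReal + K) S :=
    (hi₂.union hi₁).add (integrableOn_const (by
      refine ((measure_union_le _ _).trans_lt ?_).ne
      simp))
  have hSfin : ∫⁻ t in S, shiftedNonlinearity φ K t < ⊤ := by
    refine lt_of_le_of_lt (setLIntegral_mono_ae' hSm (ae_of_all _ fun t ht => ?_))
      hSi.hasFiniteIntegral
    have h0 : t ≠ 0 := by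
      rcases ht with ht | ht
      · exact ht.2.ne
      · exact ht.1.ne'
    rw [shiftedNonlinearity_eq K (hφ.ne_top t h0) (hφ.ne_bot t)]
    exact Real.ofReal_le_enorm _
  set c₀ := (∫⁻ t in S, shiftedNonlinearity φ K t).toReal with hc₀
  refine ⟨c₀, 2 * D, ENNReal.toReal_nonneg, by positivity, fun R hR => ?_⟩
  calc ∫⁻ t in Icc (-R) R, shiftedNonlinearity φ K t
      ≤ ∫⁻ t in Icc (-R) R, (S.indicator (shiftedNonlinearity φ K) t + ENNReal.ofReal D) := by
        refine lintegral_mono_ae ?_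
        have hne : ∀ᵐ t ∂(volume.restrict (Icc (-R) R)), t ≠ (0 : ℝ) :=
          ae_restrict_of_ae (by simp [ae_iff])
        filter_upwards [hne] with t ht
        by_cases htS : t ∈ S
        · rw [indicator_of_mem htS]; exact le_self_add
        · refine le_trans ?_ le_add_self
          have h12 : 1 / 2 ≤ |t| := by
            by_contra hlt
            obtain ⟨h1, h2⟩ := abs_lt.1 (not_le.1 hlt)
            rcases lt_or_gt_of_ne ht with h | h
            · exact htS (Or.inl ⟨h1, h⟩)
            · exact htS (Or.inr ⟨h, h2⟩)
          rw [shiftedNonlinearity_eq K (hφ.ne_top t ht) (hφ.ne_bot t)]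
          refine ENNReal.ofReal_le_ofReal ?_
          have := (abs_le.1 (hC t h12)).2
          linarith [le_abs_self (C + K)]
    _ = (∫⁻ t in Icc (-R) R, S.indicator (shiftedNonlinearity φ K) t) +
          ENNReal.ofReal D * ENNReal.ofReal (2 * R) := by
        rw [lintegral_add_right _ measurable_const, lintegral_const, Measure.restrict_apply_univ,
          Real.volume_Icc]
        congr 3; ring
    _ ≤ (∫⁻ t, S.indicator (shiftedNonlinearity φ K) t) +
          ENNReal.ofReal D * ENNReal.ofReal (2 * R) := by
        gcongr
        exact Measure.restrict_le_self
    _ = ENNReal.ofReal (c₀ + 2 * D * R) := by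
        rw [lintegral_indicator hSm, ← ENNReal.ofReal_toReal hSfin.ne, ← hc₀,
          ← ENNReal.ofReal_mul (abs_nonneg _),
          ← ENNReal.ofReal_add ENNReal.toReal_nonneg (by positivity)]
        congr 1; ring

theorem exists_measurable_inverse_coefficient {L : ℝ} {a : ℝ → ℝ} (ha : IsCoefficient L a) :
    ∃ (m : ℝ → ℝ) (m₀ m₁ : ℝ), Measurable m ∧ 0 < m₀ ∧ (∀ x, m₀ ≤ m x) ∧ (∀ x, m x ≤ m₁) ∧
      ∀ᵐ x ∂(intervalMeasure L), a x * m x = 1 := by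
  obtain ⟨ha, α, β, hα, hαβ, hab⟩ := ha
  have hβ : 0 < β := hα.trans hαβ
  set b := ha.1.mk a with hb
  have hbm : Measurable b := ha.1.stronglyMeasurable_mk.measurable
  refine ⟨fun x => (max α (min β (b x)))⁻¹, β⁻¹, α⁻¹,
    -- Clamping a measurable representative to `[α, β]` makes the bounds hold at every real point,
    -- although those on `a` hold only almost everywhere in `(0, L)`.
    (measurable_const.max (measurable_const.min hbm)).inv, inv_pos.2 hβ, fun x => ?_, fun x => ?_, ?_⟩
  · have h : 0 < max α (min β (b x)) := hα.trans_le (le_max_left _ _)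
    exact inv_anti₀ h (max_le hαβ.le (min_le_left _ _))
  · exact inv_anti₀ hα (le_max_left _ _)
  · filter_upwards [hab, ha.1.ae_eq_mk] with x hx hxe
    simp only [hb]
    rw [← hxe, min_eq_right hx.2, max_eq_right hx.1]
    exact mul_inv_cancel₀ (hα.trans_le hx.1).ne'

/-- Any profile in `H¹₀` with `φ(u) ∈ L²` solves the problem for the datum `a u' - φ(u)`. The
equation therefore constrains the profile only on `[0, T]`, where the datum is prescribed. -/
theorem exists_goodData_of_profile {L T : ℝ} (hL : 0 ≤ L) {a g : ℝ → ℝ} (ha : IsCoefficient L a)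
    {φ : ℝ → EReal} {K : ℝ} (hK : ∀ s, ((-K : ℝ) : EReal) ≤ φ s) {u h p : ℝ → ℝ}
    (hu : Continuous u) (hh : MemLp h 2 volume) (hp : MemLp p 2 volume) (hp0 : ∀ x, 0 ≤ p x)
    (hup : ∀ᵐ x ∂(intervalMeasure L), shiftedNonlinearity φ K (u x) = ENNReal.ofReal (p x))
    (hux : ∀ x ∈ Icc 0 L, u x = ∫ t in 0..x, h t) (huL : u L = 0)
    (heq : ∀ᵐ x ∂(intervalMeasure L), x ∈ Icc 0 T → a x * h x = p x - K + g x) :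
    ∃ g' ∈ goodData L a φ, ∀ x ∈ Icc 0 T, g' x = g x := by
  classical
  -- The formula agrees with `g` only almost everywhere on `[0, T]`; the case split gives equality
  -- at every point.
  set g' : ℝ → ℝ := fun x => if x ∈ Icc 0 T then g x else a x * h x - (p x - K) with hg'
  have hg'eq : g' =ᵐ[intervalMeasure L] fun x => a x * h x - (p x - K) := by
    filter_upwards [heq] with x hx
    by_cases hxT : x ∈ Icc 0 T
    · simp only [hg', if_pos hxT, hx hxT]; ring
    · simp only [hg', if_neg hxT]
  have hhL : MemLp h 2 (intervalMeasure L) := hh.restrict _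
  have hpL : MemLp p 2 (intervalMeasure L) := hp.restrict _
  obtain ⟨ham, α, β, hα, hαβ, hab⟩ := ha
  have hah : MemLp (fun x => a x * h x) 2 (intervalMeasure L) := by
    refine hhL.of_le_mul (c := β) (ham.1.mul hhL.1) ?_
    filter_upwards [hab] with x hx
    rw [norm_mul]
    gcongr
    rw [Real.norm_eq_abs, abs_of_pos (hα.trans_le hx.1)]
    exact hx.2
  have hφu : ∀ᵐ x ∂(intervalMeasure L),
      (φ (u x) ≠ ⊤ ∧ φ (u x) ≠ ⊥) ∧ (φ (u x)).toReal = p x - K := by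
    filter_upwards [hup] with x hx
    exact toReal_eq_of_shiftedNonlinearity_eq (hp0 x) (hK _) hx
  have hpK : MemLp (fun x => p x - K) 2 (intervalMeasure L) := hpL.sub (memLp_const K)
  have hφL : MemLp (fun x => (φ (u x)).toReal) 2 (intervalMeasure L) :=
    hpK.ae_eq (by filter_upwards [hφu] with x hx using hx.2.symm)
  have hg'L : MemLp g' 2 (intervalMeasure L) := (hah.sub hpK).ae_eq hg'eq.symm
  have huL2 : MemLp u 2 (intervalMeasure L) := by
    obtain ⟨C, hC⟩ := isCompact_Icc.exists_bound_of_continuousOn (hu.continuousOn (s := Icc 0 L))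
    refine MemLp.of_bound hu.aestronglyMeasurable C ?_
    exact (ae_restrict_iff' measurableSet_Ioo).2
      (ae_of_all _ fun x hx => hC x (Ioo_subset_Icc_self hx))
  refine ⟨g', ⟨hg'L, u, h, ⟨hu.continuousOn, huL2, hhL,
    isWeakDeriv_of_eq_integral hL (hh.intervalIntegrable_real 0 L) hux, ?_, huL⟩,
    ⟨hφu.mono fun x hx => hx.1, hφL⟩, fun η hη => ?_⟩, fun x hx => by simp only [hg', if_pos hx]⟩
  · rw [hux 0 ⟨le_rfl, hL⟩, intervalIntegral.integral_same]
  · rw [← integral_add (hη.integrable_mul_deriv hφL) (hη.integrable_mul_deriv hg'L)]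
    refine integral_congr_ae ?_
    filter_upwards [hφu, hg'eq] with x hx hx'
    rw [hx.2, hx']
    ring

theorem quasiMeasurePreserving_sub_mul (d : ℝ) {c : ℝ} (hc : c ≠ 0) :
    Measure.QuasiMeasurePreserving (fun x : ℝ => d - c * x) volume volume := by
  have h1 : Measure.QuasiMeasurePreserving (fun x : ℝ => c * x) volume volume := by
    refine ⟨measurable_const_mul c, ?_⟩
    rw [Real.map_volume_mul_left hc]
    exact Measure.smul_absolutelyContinuous
  exact (Measure.measurePreserving_sub_left volume d).quasiMeasurePreserving.comp h1

theorem MeasureTheory.MemLp.comp_sub_mul {f : ℝ → ℝ} (hf : MemLp f 2 volume) (d : ℝ) {c : ℝ}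
    (hc : c ≠ 0) : MemLp (fun x => f (d - c * x)) 2 volume := by
  refine (memLp_two_iff_integrable_sq
    (hf.1.comp_quasiMeasurePreserving (quasiMeasurePreserving_sub_mul d hc))).2 ?_
  exact (hf.integrable_sq.comp_sub_left d).comp_mul_left' hc

theorem MeasureTheory.MemLp.ite_le {f g : ℝ → ℝ} (hf : MemLp f 2 volume) (hg : MemLp g 2 volume)
    (c : ℝ) : MemLp (fun x => if x ≤ c then f x else g x) 2 volume := by
  classical
  exact MemLp.piecewise (s := Iic c) measurableSet_Iic (hf.restrict _) (hg.restrict _)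

theorem MeasureTheory.MemLp.mul_of_bounded {p m : ℝ → ℝ} {M : ℝ} (hp : MemLp p 2 volume)
    (hm : Measurable m) (hM : ∀ x, |m x| ≤ M) : MemLp (fun x => p x * m x) 2 volume := by
  refine hp.of_le_mul (c := M) (hp.1.mul hm.aestronglyMeasurable) (ae_of_all _ fun x => ?_)
  rw [norm_mul, mul_comm]
  gcongr
  exact hM x

/-! ### Construction of the profile and conclusion -/

/-- The data can be continued so that the solution of the singular equation is positive at the
right end point. -/
theorem exists_positive_end {ψ : ℝ → ℝ≥0∞} (hψ : Continuous ψ) {c₀ c₁ : ℝ}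
    (hc₀ : 0 ≤ c₀) (hc₁ : 0 ≤ c₁)
    (hψi : ∀ R, 0 ≤ R → ∫⁻ t in Icc (-R) R, ψ t ≤ ENNReal.ofReal (c₀ + c₁ * R))
    {m : ℝ → ℝ} {m₀ m₁ : ℝ} (hm : Measurable m) (hm₀ : 0 < m₀) (hml : ∀ x, m₀ ≤ m x)
    (hmu : ∀ x, m x ≤ m₁) {g : ℝ → ℝ} (hg : MemLp g 2 volume) {T S : ℝ} (hT : 0 ≤ T)
    (hTS : T < S) :
    ∃ u p h : ℝ → ℝ, Continuous u ∧ MemLp p 2 volume ∧ MemLp h 2 volume ∧ (∀ x, 0 ≤ p x) ∧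
      (∀ᵐ x, x ∈ Icc 0 S → ψ (u x) = ENNReal.ofReal (p x)) ∧
      (∀ x ∈ Icc 0 S, u x = ∫ t in 0..x, h t) ∧ 0 < u S ∧
      ∀ x ∈ Icc 0 T, h x = (p x + g x) * m x := by
  have hS : 0 ≤ S := hT.trans hTS.le
  have hmpos : ∀ x, 0 < m x := fun x => hm₀.trans_le (hml x)
  have hmabs : ∀ x, |m x| ≤ m₁ := fun x => by
    rw [abs_of_pos (hmpos x)]; exact hmu x
  set e : ℝ → ℝ := (Ioc T S).indicator fun _ => 1 with he
  have heL : MemLp e 2 volume :=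
    memLp_indicator_const 2 measurableSet_Ioc 1 (Or.inr (by simp))
  have hi : ∀ {f : ℝ → ℝ}, MemLp f 2 volume → ∀ a b,
      IntervalIntegrable (fun t => f t * m t) volume a b := fun hf a b =>
    (hf.intervalIntegrable_real a b).mul_of_bounded hm hmabs
  set J := ∫ t in 0..S, e t * m t with hJ
  have hJpos : 0 < J := by
    have h1 : 0 ≤ ∫ t in 0..T, e t * m t := intervalIntegral.integral_nonneg hT fun t _ =>
      mul_nonneg (indicator_nonneg (fun _ _ => zero_le_one) t) (hmpos t).le
    have h2 : 0 < ∫ t in T..S, e t * m t := by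
      refine intervalIntegral.intervalIntegral_pos_of_pos_on (hi heL T S) (fun t ht => ?_) hTS
      rw [he, indicator_of_mem (Ioo_subset_Ioc_self ht), one_mul]
      exact hmpos t
    rw [hJ, ← intervalIntegral.integral_add_adjacent_intervals (hi heL 0 T) (hi heL T S)]
    linarith
  -- With this `k` the forcing `g + k e` contributes exactly `1` to `u S`; the singular term only
  -- adds to it, as `p ≥ 0`.
  set k : ℝ := (1 - ∫ t in 0..S, g t * m t) / J with hk
  have hgL : MemLp (fun t => g t + k * e t) 2 volume := hg.add (heL.const_mul k)
  obtain ⟨u, p, huc, hpL, hp0, hup, hux⟩ :=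
    exists_singular_ode_solution hψ hc₀ hc₁ hψi hm hm₀ hml hmu hgL hS
  refine ⟨u, p, fun t => (p t + (g t + k * e t)) * m t, huc, hpL,
    (hpL.add hgL).mul_of_bounded hm hmabs, hp0, hup, hux, ?_, fun x hx => ?_⟩
  · rw [hux S ⟨hS, le_rfl⟩]
    have h1 : ∫ t in 0..S, (p t + (g t + k * e t)) * m t =
        (∫ t in 0..S, p t * m t) + ((∫ t in 0..S, g t * m t) + k * J) := by
      rw [hJ, ← intervalIntegral.integral_const_mul,
        ← intervalIntegral.integral_add (hi hg 0 S) ((hi heL 0 S).const_mul k),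
        ← intervalIntegral.integral_add (hi hpL 0 S) ((hi hg 0 S).add ((hi heL 0 S).const_mul k))]
      refine intervalIntegral.integral_congr fun t _ => ?_
      ring
    have h2 : 0 ≤ ∫ t in 0..S, p t * m t := intervalIntegral.integral_nonneg hS fun t _ =>
      mul_nonneg (hp0 t) (hmpos t).le
    have h3 : k * J = 1 - ∫ t in 0..S, g t * m t := div_mul_cancel₀ _ hJpos.ne'
    rw [h1, h3]
    linarith
  · have : e x = 0 := indicator_of_notMem (fun h => not_lt.2 hx.2 h.1) _
    simp [this]

/-- A profile that starts from zero and reaches a prescribed positive value. -/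
theorem exists_profile_reaching {ψ : ℝ → ℝ≥0∞} (hψ : Continuous ψ) {c₀ c₁ : ℝ}
    (hc₀ : 0 ≤ c₀) (hc₁ : 0 ≤ c₁)
    (hψi : ∀ R, 0 ≤ R → ∫⁻ t in Icc (-R) R, ψ t ≤ ENNReal.ofReal (c₀ + c₁ * R))
    {s : ℝ} (hs : 0 < s) :
    ∃ (v p h : ℝ → ℝ) (y : ℝ), 0 < y ∧ Continuous v ∧ MemLp p 2 volume ∧ MemLp h 2 volume ∧
      (∀ x, 0 ≤ p x) ∧ (∀ᵐ x, x ∈ Icc 0 y → ψ (v x) = ENNReal.ofReal (p x)) ∧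
      (∀ x ∈ Icc 0 y, v x = ∫ t in 0..x, h t) ∧ v y = s := by
  -- The forcing alone reaches `s` at time `1`, and `p ≥ 0` only helps, so `s` is attained at some
  -- `y ≤ 1`. A straight line would not suffice: `ψ` is only integrable near `0`, while `ψ(v)` must
  -- be square integrable.
  set e : ℝ → ℝ := (Ioc 0 1).indicator fun _ => s with he
  have heL : MemLp e 2 volume :=
    memLp_indicator_const 2 measurableSet_Ioc s (Or.inr (by simp))
  obtain ⟨v, p, hvc, hpL, hp0, hvp, hvx⟩ := exists_singular_ode_solution hψ hc₀ hc₁ hψi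
    (m := fun _ => 1) (m₀ := 1) (m₁ := 1) measurable_const one_pos (fun _ => le_rfl)
    (fun _ => le_rfl) heL zero_le_one
  simp only [mul_one] at hvx
  have hv0 : v 0 = 0 := by rw [hvx 0 (by simp)]; simp
  have hv1 : s ≤ v 1 := by
    rw [hvx 1 (by simp), intervalIntegral.integral_add (hpL.intervalIntegrable_real 0 1)
      (heL.intervalIntegrable_real 0 1)]
    have h1 : 0 ≤ ∫ t in (0 : ℝ)..1, p t :=
      intervalIntegral.integral_nonneg zero_le_one fun t _ => hp0 t
    have h2 : ∫ t in (0 : ℝ)..1, e t = s := by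
      rw [intervalIntegral.integral_of_le zero_le_one, he,
        setIntegral_congr_fun measurableSet_Ioc
          (fun t ht => indicator_of_mem ht _ : EqOn _ (fun _ => s) _)]
      simp
    linarith
  obtain ⟨y, hy, hys⟩ := intermediate_value_Icc zero_le_one hvc.continuousOn
    (⟨by rw [hv0]; exact hs.le, hv1⟩ : s ∈ Icc (v 0) (v 1))
  have hy0 : y ≠ 0 := by rintro rfl; rw [hv0] at hys; exact hs.ne hys
  have hsub : Icc 0 y ⊆ Icc 0 1 := Icc_subset_Icc_right hy.2
  exact ⟨v, p, fun t => p t + e t, y, lt_of_le_of_ne hy.1 hy0.symm, hvc, hpL, hpL.add heL, hp0,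
    hvp.mono fun x hx hxy => hx (hsub hxy), fun x hx => hvx x (hsub hx), hys⟩

/-- Continuation of a profile on `[0, S]`, positive at `S`, to a profile on `[0, L]` which vanishes
at `L`. -/
theorem exists_profile_extension {ψ : ℝ → ℝ≥0∞} (hψ : Continuous ψ) {c₀ c₁ : ℝ}
    (hc₀ : 0 ≤ c₀) (hc₁ : 0 ≤ c₁)
    (hψi : ∀ R, 0 ≤ R → ∫⁻ t in Icc (-R) R, ψ t ≤ ENNReal.ofReal (c₀ + c₁ * R))
    {S L : ℝ} (hS : 0 ≤ S) (hSL : S < L) {u p h : ℝ → ℝ} (hu : Continuous u)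
    (hp : MemLp p 2 volume) (hh : MemLp h 2 volume) (hp0 : ∀ x, 0 ≤ p x)
    (hup : ∀ᵐ x, x ∈ Icc 0 S → ψ (u x) = ENNReal.ofReal (p x))
    (hux : ∀ x ∈ Icc 0 S, u x = ∫ t in 0..x, h t) (huS : 0 < u S) :
    ∃ w q k : ℝ → ℝ, Continuous w ∧ MemLp q 2 volume ∧ MemLp k 2 volume ∧ (∀ x, 0 ≤ q x) ∧
      (∀ᵐ x, x ∈ Icc 0 L → ψ (w x) = ENNReal.ofReal (q x)) ∧
      (∀ x ∈ Icc 0 L, w x = ∫ t in 0..x, k t) ∧ w L = 0 ∧ ∀ x ≤ S, q x = p x ∧ k x = h x := by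
  obtain ⟨v, r, l, y, hy, hv, hr, hl, hr0, hvr, hvx, hvy⟩ :=
    exists_profile_reaching hψ hc₀ hc₁ hψi huS
  have hLS : 0 < L - S := sub_pos.2 hSL
  -- The map `x ↦ c L - c x` sends `[S, L]` onto `[0, y]` with reversed orientation. The rescaled
  -- profile need not satisfy the original equation; only the `L²` bounds must survive.
  set c : ℝ := y / (L - S) with hc
  have hc0 : 0 < c := div_pos hy hLS
  have hcy : c * L - c * S = y := by rw [← mul_sub, hc, div_mul_cancel₀ _ hLS.ne']
  have hmem : ∀ x ∈ Icc S L, c * L - c * x ∈ Icc 0 y := fun x hx => by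
    have h1 := mul_le_mul_of_nonneg_left hx.1 hc0.le
    have h2 := mul_le_mul_of_nonneg_left hx.2 hc0.le
    exact ⟨by linarith, by linarith⟩
  have hkL : MemLp (fun x => if x ≤ S then h x else -c * l (c * L - c * x)) 2 volume :=
    hh.ite_le ((hl.comp_sub_mul (c * L) hc0.ne').const_mul (-c)) S
  refine ⟨fun x => if x ≤ S then u x else v (c * L - c * x),
    fun x => if x ≤ S then p x else r (c * L - c * x),
    fun x => if x ≤ S then h x else -c * l (c * L - c * x), ?_,
    hp.ite_le (hr.comp_sub_mul (c * L) hc0.ne') S, hkL, fun x => ?_, ?_, ?_, ?_, fun x hx => ?_⟩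
  · refine Continuous.if_le hu (hv.comp (by fun_prop)) continuous_id continuous_const ?_
    rintro x rfl
    rw [hcy, hvy]
  · dsimp only
    split_ifs
    · exact hp0 x
    · exact hr0 _
  · filter_upwards [hup, (quasiMeasurePreserving_sub_mul (c * L) hc0.ne').ae hvr] with x h1 h2 hx
    by_cases hxS : x ≤ S
    · simp only [if_pos hxS]
      exact h1 ⟨hx.1, hxS⟩
    · simp only [if_neg hxS]
      exact h2 (hmem x ⟨(not_le.1 hxS).le, hx.2⟩)
  · have hleft : ∀ x ∈ Icc 0 S, u x =
        ∫ t in 0..x, if t ≤ S then h t else -c * l (c * L - c * t) := fun x hx => by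
      rw [hux x hx]
      refine intervalIntegral.integral_congr fun t ht => ?_
      rw [uIcc_of_le hx.1] at ht
      simp only [if_pos (ht.2.trans hx.2)]
    intro x hx
    dsimp only
    by_cases hxS : x ≤ S
    · rw [if_pos hxS]
      exact hleft x ⟨hx.1, hxS⟩
    · have hSx := (not_le.1 hxS).le
      rw [if_neg hxS, ← intervalIntegral.integral_add_adjacent_intervals
        (hkL.intervalIntegrable_real 0 S) (hkL.intervalIntegrable_real S x),
        ← hleft S ⟨hS, le_rfl⟩]
      have h1 : ∫ t in S..x, (if t ≤ S then h t else -c * l (c * L - c * t)) =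
          ∫ t in S..x, -c * l (c * L - c * t) := by
        refine intervalIntegral.integral_congr_ae (ae_of_all _ fun t ht => ?_)
        rw [uIoc_of_le hSx] at ht
        simp only [if_neg (not_le.2 ht.1)]
      rw [h1, intervalIntegral.integral_const_mul, intervalIntegral.integral_comp_sub_mul _ hc0.ne',
        hcy, smul_eq_mul, ← mul_assoc, neg_mul, mul_inv_cancel₀ hc0.ne', neg_one_mul,
        ← intervalIntegral.integral_interval_sub_left (hl.intervalIntegrable_real 0 y)
          (hl.intervalIntegrable_real 0 _), ← hvx y ⟨hy.le, le_rfl⟩,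
        ← hvx _ (hmem x ⟨hSx, hx.2⟩), hvy]
      ring
  · dsimp only
    rw [if_neg (not_le.2 hSL), sub_self, hvx 0 ⟨le_rfl, hy.le⟩, intervalIntegral.integral_same]
  · exact ⟨if_pos hx, if_pos hx⟩

theorem mainTheorem8 (L : ℝ) (hL : 0 < L) (a : ℝ → ℝ) (ha : IsCoefficient L a)
    (φ : ℝ → EReal) (hφ : IsNonlinearity φ) (hφ_zero : φ 0 = ⊤)
    (hφ_int : IsIntegrableNearZero φ) (hφ_bdd : IsBoundedAwayFromZero φ) :
    ∀ g : ℝ → ℝ, MemLp g 2 (intervalMeasure L) → ∀ δ : ℝ, 0 < δ → δ < L →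
      ∃ g' ∈ goodData L a φ, ∀ x ∈ Icc 0 (L - δ), g' x = g x := by
  intro g hg δ hδ hδL
  obtain ⟨K, -, hK⟩ := hφ.exists_lower_bound hφ_bdd
  obtain ⟨c₀, c₁, hc₀, hc₁, hψi⟩ := exists_lintegral_shiftedNonlinearity_le hφ hφ_int hφ_bdd K
  have hψ := continuous_shiftedNonlinearity hφ.continuous K
  obtain ⟨m, m₀, m₁, hm, hm₀, hml, hmu, ham⟩ := exists_measurable_inverse_coefficient ha
  -- The shift is compensated in the datum: `φ + g = ψ + (g - K)`.
  have hgK : MemLp ((Ioo 0 L).indicator fun x => g x - K) 2 volume :=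
    (memLp_indicator_iff_restrict measurableSet_Ioo).2 (hg.sub (memLp_const K))
  -- The free interval is split at `L - δ / 2`: the first half makes the solution positive, the
  -- second brings it back to `0`.
  obtain ⟨u, p, h, hu, hp, hh, hp0, hup, hux, huS, hhx⟩ := exists_positive_end hψ hc₀ hc₁ hψi hm hm₀
    hml hmu hgK (sub_nonneg.2 hδL.le) (by linarith : L - δ < L - δ / 2)
  obtain ⟨w, q, k, hw, hq, hk, hq0, hwq, hwx, hwL, hqk⟩ := exists_profile_extension hψ hc₀ hc₁ hψi
    (by linarith) (by linarith : L - δ / 2 < L) hu hp hh hp0 hup hux huS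
  refine exists_goodData_of_profile hL.le ha hK hw hk hq hq0 ?_ hwx hwL ?_
  · exact (ae_restrict_iff' measurableSet_Ioo).2
      (hwq.mono fun x hx hxL => hx (Ioo_subset_Icc_self hxL))
  · have hmemL : ∀ᵐ x ∂(intervalMeasure L), x ∈ Ioo 0 L := ae_restrict_mem measurableSet_Ioo
    filter_upwards [ham, hmemL] with x hx hxL hxT
    obtain ⟨h1, h2⟩ := hqk x (hxT.2.trans (by linarith))
    rw [h2, h1, hhx x hxT, indicator_of_mem hxL]
    linear_combination (p x + (g x - K)) * hx
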